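/- Let $\rho>0$. For an integer $T\ge 2$ put $\mu=1/2$ and $\Delta=\sqrt{\mu(1-\mu)\,\rho\log T/T}$, and consider the two-armed bandit in which every pull of arm 1 yields the deterministic reward $\mu+\Delta$ (so $\sigma_1^2=0$), while the pulls of arm 2 yield i.i.d. Bernoulli$(\mu)$ rewards (so $\sigma_2^2=\mu(1-\mu)=1/4$). Run UCB-V with horizon $T$, exploration coefficient $\rho$ and known variances on this instance: each arm is pulled once in the first two rounds, and in every round $t=3,\dots,T$ an arm $A_t\in\arg\max_{a\in\{1,2\}}\mathrm{UCB}(a,t)$ is pulled (ties broken arbitrarily), where $$\mathrm{UCB}(a,t)=\bar X_{a,t}+\Big(\frac{\sigma_a}{\sqrt{\rho\log T}}\vee\frac1{\sqrt{n_{a,t}}}\Big)\frac{\rho\log T}{\sqrt{n_{a,t}}},$$ $n_{a,t}$ is the number of pulls of arm $a$ in the rounds $1,\dots,t-1$, and $\bar X_{a,t}$ is the empirical mean of the rewards of these pulls. Then there are constants $c_0,c_1>0$ (depending only on $\rho$) such that for all sufficiently large $T$ $$\mathbb P\big(n_{1,T}\le c_1\sqrt T\,\log T\big)>c_0\qquad\text{and}\qquad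 \mathbb P\big(n_{1,T}\ge c_1^{-1}\,T/\sqrt{\log T}\big)>c_0 .$$ Consequently $n_{1,T}$ is not asymptotically deterministic: there is no deterministic sequence $(n_T^\star)$ with $n_{1,T}/n_T^\star\to1$ in probability as $T\to\infty$. -/

import Mathlib

open MeasureTheory ProbabilityTheory Filter Topology

universe u

/-! Rounds are numbered `1, 2, 3, …`; arm `a` of a `K`-armed bandit is an element of `Fin K`. An
action sequence is a function `A : ℕ → Fin K` (its value at `0` plays no role), and `Y a i` is the
reward produced by the pull number `i + 1` of arm `a`. -/

/-- `n_{a,t}`: how often arm `a` has been pulled in the rounds `1, …, t - 1`. -/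
def pullCount {K : ℕ} (A : ℕ → Fin K) (a : Fin K) (t : ℕ) : ℕ :=
  ((Finset.Ico 1 t).filter (fun s => A s = a)).card

/-- `X_t`: the reward observed in round `t`, that is, the next unused reward of the arm `A t`. -/
def observedReward {K : ℕ} (A : ℕ → Fin K) (Y : Fin K → ℕ → ℝ) (t : ℕ) : ℝ :=
  Y (A t) (pullCount A (A t) t)

/-- The empirical mean of the rewards of arm `a` observed in the rounds `1, …, t - 1`. -/
noncomputable def empiricalMean {K : ℕ} (A : ℕ → Fin K) (Y : Fin K → ℕ → ℝ) (a : Fin K) (t : ℕ) :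
    ℝ :=
  (∑ s ∈ (Finset.Ico 1 t).filter (fun s => A s = a), observedReward A Y s) / (pullCount A a t : ℝ)

/-- The optimistic reward `UCB(a, t)` with horizon `T`, exploration coefficient `ρ`, and with `σ a`
in the place of the empirical standard deviation of arm `a`. -/
noncomputable def ucbvIndex {K : ℕ} (ρ : ℝ) (T : ℕ) (σ : Fin K → ℝ) (A : ℕ → Fin K)
    (Y : Fin K → ℕ → ℝ) (a : Fin K) (t : ℕ) : ℝ :=
  empiricalMean A Y a t +
    max (σ a / Real.sqrt (ρ * Real.log T)) (1 / Real.sqrt (pullCount A a t)) *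
      (ρ * Real.log T / Real.sqrt (pullCount A a t))

/-- `A` is a possible action sequence of UCB-V with known standard deviations `σ`, when `Y` is the
table of rewards: each arm is pulled once in the first `K` rounds (in any order), and each of the
rounds `K + 1, …, T` pulls an arm of maximal index (ties are broken in any way). -/
structure IsUCBVPath {K : ℕ} (ρ : ℝ) (T : ℕ) (σ : Fin K → ℝ) (A : ℕ → Fin K)
    (Y : Fin K → ℕ → ℝ) : Prop where
  init : ∀ a, pullCount A a (K + 1) = 1
  greedy : ∀ t, K + 1 ≤ t → t ≤ T → ∀ a, ucbvIndex ρ T σ A Y a t ≤ ucbvIndex ρ T σ A Y (A t) t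

/-- The standard deviation of a probability measure on the real line. -/
noncomputable def stdDev (ν : Measure ℝ) : ℝ := Real.sqrt (variance id ν)

/-- `(A, Y)` is a run, on the probability space `(Ω, P)`, of UCB-V with oracle variances on the
bandit with arm distributions `ν`: the rewards of all pulls of all arms are independent, those of
arm `a` have law `ν a`, and the (random) actions follow the algorithm with the true standard
deviations. Ties may be broken with the help of additional randomness on `Ω`. -/
structure IsOracleUCBVRun {K : ℕ} {Ω : Type*} [MeasurableSpace Ω] (P : Measure Ω) (ρ : ℝ) (T : ℕ)
    (ν : Fin K → Measure ℝ) (A : ℕ → Ω → Fin K) (Y : Fin K → ℕ → Ω → ℝ) : Prop where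
  law : ∀ a i, HasLaw (Y a i) (ν a) P
  indep : iIndepFun (fun p : Fin K × ℕ => Y p.1 p.2) P
  measurable_action : ∀ t, Measurable (A t)
  path : ∀ ω, IsUCBVPath ρ T (fun a => stdDev (ν a)) (fun t => A t ω) (fun a i => Y a i ω)

/-- The critical gap `Δ = √(μ (1 - μ) ρ log T / T)` with `μ = 1/2`. -/
noncomputable def criticalGap (ρ : ℝ) (T : ℕ) : ℝ :=
  Real.sqrt ((1 / 2) * (1 - 1 / 2) * ρ * Real.log T / T)

/-- The two-armed instance with `μ = 1/2`: the first arm always pays `μ + Δ` for the critical gap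
`Δ`, and the second arm pays `1` with probability `μ` and `0` with probability `1 - μ`. -/
noncomputable def criticalInstance (ρ : ℝ) (T : ℕ) : Fin 2 → Measure ℝ :=
  ![Measure.dirac (1 / 2 + criticalGap ρ T),
    bernoulliMeasure (1 : ℝ) 0 ⟨1 / 2, by norm_num, by norm_num⟩]

/-! At the critical gap, the bonus `√(ρ log T) / (2 √n)` of the random arm after `n` pulls meets the
gap `Δ = √(ρ log T) / (2 √T)` exactly at `n = T`, so that the outcome hangs on the fluctuation of the
empirical mean of the random arm, which is of order `1 / √T` at the end of the horizon. Let `W n` be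
the sum of the first `n` rescaled rewards `2 Y - 1` of this arm, a simple symmetric random walk.

* If `W` is above `√T / 4` for `n` near `T`, and never below minus a small multiple of `√(n log T)`
  until then (`highWalk`), then the index of the random arm exceeds the index of the deterministic arm as
  soon as the bonus `ρ log T / m` of the latter has dropped below `1 / (8 √T)`. Hence
  `m = O(√T log T)`; this is `IsUCBVPath.pullCount_le`, applied at the last pull of the deterministic
  arm.
* If `W` is below `-√T / 4` for `n` near `T` (`lowWalk`), then the random arm needs a bonus that
  exceeds the gap by a constant over `√T`, which it does not have once `T - n` is a small multiple of
  `T / √(log T)`. The remaining rounds belong to the deterministic arm; this is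
  `IsUCBVPath.le_pullCount`, applied at the last pull of the random arm.

Both kinds of walk have a probability bounded below (`exists_lt_measureReal_highWalk_lowWalk`). The
central limit theorem gives `W n ≥ √n` with probability at least `p` at the beginning of the final
stretch; a maximal form of Hoeffding's inequality keeps `W` there during the stretch, if the latter
has length `T / r` with `r` large in terms of `p`, and, applied to dyadic blocks, shows that the
moderate barrier is crossed with a probability that tends to `0`. All this concerns the joint law of
the rewards only, which is a product measure that does not depend on the probability space or on
`T`. -/

/-! ### Pull counts and indices along a path -/

lemma pullCount_succ {K : ℕ} (A : ℕ → Fin K) (a : Fin K) {t : ℕ} (ht : 1 ≤ t) :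
    pullCount A a (t + 1) = pullCount A a t + if A t = a then 1 else 0 := by
  unfold pullCount
  rw [← Finset.insert_Ico_right_eq_Ico_add_one ht, Finset.filter_insert]
  split_ifs with h
  · rw [Finset.card_insert_of_notMem (by simp)]
  · rfl

lemma pullCount_mono {K : ℕ} (A : ℕ → Fin K) (a : Fin K) : Monotone (pullCount A a) :=
  fun _ _ h => Finset.card_le_card
    (Finset.filter_subset_filter _ (Finset.Ico_subset_Ico_right h))

lemma pullCount_add_pullCount (A : ℕ → Fin 2) {t : ℕ} (ht : 1 ≤ t) :
    pullCount A 0 t + pullCount A 1 t + 1 = t := by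
  induction t, ht using Nat.le_induction with
  | base => simp [pullCount]
  | succ t ht ih =>
    rw [pullCount_succ A 0 ht, pullCount_succ A 1 ht]
    obtain h | h : A t = 0 ∨ A t = 1 := by generalize A t = a; fin_cases a <;> simp
    all_goals simp [h]; omega

/-- The rewards observed from an arm are the first entries of its column in the reward table. -/
lemma sum_observedReward {K : ℕ} (A : ℕ → Fin K) (Y : Fin K → ℕ → ℝ) (a : Fin K) {t : ℕ}
    (ht : 1 ≤ t) :
    ∑ s ∈ (Finset.Ico 1 t).filter (fun s => A s = a), observedReward A Y s =
      ∑ i ∈ Finset.range (pullCount A a t), Y a i := by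
  induction t, ht using Nat.le_induction with
  | base => simp [pullCount]
  | succ t ht ih =>
    rw [pullCount_succ A a ht, ← Finset.insert_Ico_right_eq_Ico_add_one ht, Finset.filter_insert]
    split_ifs with h
    · rw [Finset.sum_insert (by simp), ih, Finset.sum_range_succ, observedReward, h, add_comm]
    · simpa using ih

lemma empiricalMean_eq {K : ℕ} (A : ℕ → Fin K) (Y : Fin K → ℕ → ℝ) (a : Fin K) {t : ℕ}
    (ht : 1 ≤ t) :
    empiricalMean A Y a t =
      (∑ i ∈ Finset.range (pullCount A a t), Y a i) / (pullCount A a t : ℝ) := by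
  rw [empiricalMean, sum_observedReward A Y a ht]

/-- An arm pulled at least twice before round `T` has a last pull before `T`, and this pull comes
after the initial rounds. -/
lemma exists_last_pull {K : ℕ} {A : ℕ → Fin K} {a : Fin K} (h1 : pullCount A a (K + 1) = 1)
    {T : ℕ} (hT : 2 ≤ pullCount A a T) :
    ∃ s, K + 1 ≤ s ∧ s < T ∧ A s = a ∧ pullCount A a s + 1 = pullCount A a T := by
  classical
  have hex : ∃ u, pullCount A a T ≤ pullCount A a u := ⟨T, le_rfl⟩
  set u := Nat.find hex with hu
  have hu1 : pullCount A a T ≤ pullCount A a u := Nat.find_spec hex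
  have huT : u ≤ T := Nat.find_min' hex le_rfl
  have hKu : K + 1 < u := by
    by_contra hcon
    have := pullCount_mono A a (not_lt.mp hcon)
    omega
  obtain ⟨s, hs⟩ : ∃ s, u = s + 1 := ⟨u - 1, by omega⟩
  have hlt : ¬ pullCount A a T ≤ pullCount A a s := Nat.find_min hex (by omega)
  have hstep := pullCount_succ A a (t := s) (by omega)
  rw [hs] at hu1
  refine ⟨s, by omega, by omega, ?_, ?_⟩
  · by_contra hne
    simp [hne] at hstep
    omega
  · split_ifs at hstep <;> omega

section Path

variable {ρ : ℝ} {T : ℕ} {A : ℕ → Fin 2} {Y : Fin 2 → ℕ → ℝ} {σ : Fin 2 → ℝ}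

/-- Both arms have been pulled before every round after the initial ones. -/
lemma IsUCBVPath.one_le_pullCount (h : IsUCBVPath ρ T σ A Y) (a : Fin 2) {t : ℕ} (ht : 3 ≤ t) :
    1 ≤ pullCount A a t :=
  (h.init a).symm.le.trans (pullCount_mono A a ht)

/-- The index of an arm with the constant reward `m` and no variance. -/
lemma ucbvIndex_of_const {m : ℝ} (h0 : ∀ i, Y 0 i = m) (hσ : σ 0 = 0) {t : ℕ} (ht : 1 ≤ t)
    (hn : 1 ≤ pullCount A 0 t) :
    ucbvIndex ρ T σ A Y 0 t = m + ρ * Real.log T / (pullCount A 0 t : ℝ) := by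
  have hn' : (0 : ℝ) < pullCount A 0 t := by exact_mod_cast hn
  rw [ucbvIndex, empiricalMean_eq A Y 0 ht]
  simp only [h0, Finset.sum_const, Finset.card_range, nsmul_eq_mul, hσ, zero_div]
  rw [max_eq_right (by positivity), mul_div_cancel_left₀ _ hn'.ne', div_mul_div_comm, one_mul,
    Real.mul_self_sqrt hn'.le]

/-- The index of an arm of standard deviation `1 / 2`, in terms of the rewards rescaled to `2 Y - 1`,
which are signs when `Y` takes the values `0` and `1`. -/
lemma ucbvIndex_of_half (hσ : σ 1 = 1 / 2) {t : ℕ} (ht : 1 ≤ t) (hL : 0 < ρ * Real.log T)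
    {n : ℕ} (hn1 : 1 ≤ n) (hn : pullCount A 1 t = n) :
    ucbvIndex ρ T σ A Y 1 t = 1 / 2 + (∑ i ∈ Finset.range n, (2 * Y 1 i - 1)) / (2 * n) +
      max (√(ρ * Real.log T) / (2 * √n)) (ρ * Real.log T / n) := by
  have hn' : (0 : ℝ) < n := by exact_mod_cast hn1
  have hs : 0 < √(n : ℝ) := Real.sqrt_pos.2 hn'
  have hLs : 0 < √(ρ * Real.log T) := Real.sqrt_pos.2 hL
  rw [ucbvIndex, empiricalMean_eq A Y 1 ht, hn, hσ, max_mul_of_nonneg _ _ (by positivity)]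
  congr 1
  · rw [Finset.sum_sub_distrib, ← Finset.mul_sum]
    simp only [Finset.sum_const, Finset.card_range, nsmul_eq_mul]
    field_simp
    ring
  · congr 1
    · rw [div_mul_div_comm, div_eq_div_iff (by positivity) (by positivity)]
      have := Real.mul_self_sqrt hL.le
      linear_combination -√(n : ℝ) * this
    · rw [div_mul_div_comm, one_mul, Real.mul_self_sqrt hn'.le]

/-! ### The two regimes of a path -/

lemma criticalGap_eq (ρ : ℝ) (T : ℕ) : criticalGap ρ T = √(ρ * Real.log T) / (2 * √T) := by
  rw [criticalGap, show (1 / 2 * (1 - 1 / 2) * ρ * Real.log T / T : ℝ) =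
    (ρ * Real.log T) / (2 ^ 2 * T) by ring, Real.sqrt_div' _ (by positivity),
    Real.sqrt_mul (by norm_num : (0 : ℝ) ≤ 2 ^ 2), Real.sqrt_sq (by norm_num)]

/-- The sequences of increments whose partial sums stay above the moderate barrier `-h √n` up to time
`T`, and above `√T / 4` during the last `T / r` steps (rounded down) before `T`. -/
def highWalk (r T : ℕ) (h : ℝ) : Set (ℕ → ℝ) :=
  {x | (∀ n, 1 ≤ n → n ≤ T → -(h * √n) ≤ ∑ i ∈ Finset.range n, x i) ∧
    ∀ n, T - T / r ≤ n → n ≤ T → √T / 4 ≤ ∑ i ∈ Finset.range n, x i}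

/-- The sequences of increments whose partial sums stay below `-√T / 4` during the last `T / r` steps
(rounded down) before `T`. -/
def lowWalk (r T : ℕ) : Set (ℕ → ℝ) :=
  {x | ∀ n, T - T / r ≤ n → n ≤ T → ∑ i ∈ Finset.range n, x i ≤ -(√T / 4)}

/-- On a high walk the random arm looks better than the deterministic one as soon as the latter has
been pulled `c √T log T` times, whatever the number of its own pulls: late on by the excess of its
mean, and earlier by the surplus of its bonus over the gap. -/
lemma IsUCBVPath.pullCount_le (h : IsUCBVPath ρ T σ A Y) (hρ : 0 < ρ)
    (h0 : ∀ i, Y 0 i = 1 / 2 + criticalGap ρ T) (hσ0 : σ 0 = 0) (hσ1 : σ 1 = 1 / 2) {r : ℕ}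
    (hr : 2 ≤ r) {c : ℝ} (hc : 17 * ρ ≤ c) (hbig : 2 ≤ c * (√(T : ℝ) * Real.log T))
    (hlog : (r : ℝ) ^ 2 < ρ * Real.log T)
    (hx : (fun i => 2 * Y 1 i - 1) ∈ highWalk r T (√(ρ * Real.log T) / (4 * r))) :
    (pullCount A 0 T : ℝ) ≤ c * (√(T : ℝ) * Real.log T) := by
  by_contra! hlt
  have hcpos : 0 < c := by linarith
  have h2 : 2 ≤ pullCount A 0 T := by
    have : (2 : ℝ) ≤ pullCount A 0 T := by linarith
    exact_mod_cast this
  obtain ⟨s, hs3, hsT, hAs, hcount⟩ := exists_last_pull (h.init 0) h2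
  have hs3 : 3 ≤ s := hs3
  have hg := h.greedy s hs3 hsT.le 1
  have hr0 : (2 : ℝ) ≤ r := by exact_mod_cast hr
  have hL : 0 < ρ * Real.log T := lt_of_le_of_lt (by positivity) hlog
  have hlogpos : 0 < Real.log T := (mul_pos_iff_of_pos_left hρ).mp hL
  obtain ⟨n, hn⟩ : ∃ n, pullCount A 1 s = n := ⟨_, rfl⟩
  have hn1 : 1 ≤ n := hn ▸ h.one_le_pullCount 1 hs3
  have hm1 := h.one_le_pullCount 0 hs3
  have hsum := pullCount_add_pullCount A (t := s) (by omega)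
  have hnT : n ≤ T := by omega
  rw [hAs, ucbvIndex_of_const h0 hσ0 (by omega) hm1,
    ucbvIndex_of_half hσ1 (by omega) hL hn1 hn, criticalGap_eq] at hg
  set W := ∑ i ∈ Finset.range n, (2 * Y 1 i - 1) with hW
  set q := √(ρ * Real.log T) with hq
  have hTpos : (0 : ℝ) < T := by exact_mod_cast (by omega : 0 < T)
  have hnpos : (0 : ℝ) < n := by exact_mod_cast hn1
  have hsT : 0 < √(T : ℝ) := Real.sqrt_pos.2 hTpos
  have hsn : 0 < √(n : ℝ) := Real.sqrt_pos.2 hnpos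
  have hsnT : √(n : ℝ) ≤ √T := Real.sqrt_le_sqrt (by exact_mod_cast hnT)
  have hqr : r < q := by
    rw [hq]; exact Real.lt_sqrt_of_sq_lt hlog
  have hmR : c * (√(T : ℝ) * Real.log T) / 2 ≤ pullCount A 0 s := by
    have : (pullCount A 0 s : ℝ) + 1 = pullCount A 0 T := by exact_mod_cast hcount
    linarith
  -- the bonus of the deterministic arm is below the lead `1 / (8 √T)` that a high walk ends with
  have hbonus : ρ * Real.log T / (pullCount A 0 s : ℝ) < 1 / (8 * √T) := by
    rw [div_lt_div_iff₀ (by exact_mod_cast hm1) (by positivity)]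
    have : 17 * ρ * (√(T : ℝ) * Real.log T) ≤ c * (√(T : ℝ) * Real.log T) := by gcongr
    have : 0 < ρ * (√(T : ℝ) * Real.log T) := by positivity
    nlinarith
  have hmain : W / (2 * n) + q / (2 * √n) < q / (2 * √T) + 1 / (8 * √T) := by
    have := le_max_left (q / (2 * √n)) (ρ * Real.log T / n)
    linarith
  by_cases hcase : T - T / r ≤ n
  · have hWn := hx.2 n hcase hnT
    rw [← hW] at hWn
    have e1 : 1 / (8 * √T) ≤ W / (2 * n) := by
      rw [div_le_div_iff₀ (by positivity) (by positivity)]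
      have h1 : √(T : ℝ) * √T = T := Real.mul_self_sqrt hTpos.le
      have h2 : (n : ℝ) ≤ T := by exact_mod_cast hnT
      nlinarith
    have e2 : q / (2 * √T) ≤ q / (2 * √n) := by gcongr
    linarith
  · have hWn := hx.1 n hn1 hnT
    rw [← hW] at hWn
    have hnn : √(n : ℝ) * √n = n := Real.mul_self_sqrt hnpos.le
    have e1 : -(q / (8 * r)) / √n ≤ W / (2 * n) := by
      rw [div_le_div_iff₀ (by positivity) (by positivity)]
      calc -(q / (8 * r)) * (2 * n) = -(q / (4 * r) * √n) * √n := by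
            rw [neg_mul, neg_mul, mul_assoc (q / (4 * r)), hnn]; field_simp; ring
        _ ≤ W * √n := by gcongr
    -- `√(1 - 1 / r) ≤ 1 - 1 / (2 r)`, so that the bonus exceeds the gap by a factor
    have hratio : √(n : ℝ) ≤ (1 - 1 / (2 * r)) * √T := by
      apply Real.sqrt_le_iff.2
      have hfac : 0 ≤ 1 - 1 / (2 * (r : ℝ)) := by
        rw [sub_nonneg, div_le_one (by positivity)]; linarith
      refine ⟨by positivity, ?_⟩
      rw [mul_pow, Real.sq_sqrt hTpos.le]
      have hlt : n + T / r + 1 ≤ T := by omega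
      have hlt' : (n : ℝ) + (T / r : ℕ) + 1 ≤ T := by exact_mod_cast hlt
      have hdiv : (T : ℝ) / r < (T / r : ℕ) + 1 := by
        rw [← Nat.floor_div_eq_div (K := ℝ)]
        exact Nat.lt_floor_add_one _
      have : (1 - 1 / (2 * (r : ℝ))) ^ 2 * T = T - T / r + (1 / (2 * r)) ^ 2 * T := by
        field_simp; ring
      have : 0 ≤ (1 / (2 * (r : ℝ))) ^ 2 * T := by positivity
      linarith
    have e2 : (q / 2 + 1 / 8) * √n ≤ (q / 2 + 1 / 8) * ((1 - 1 / (2 * r)) * √T) := by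
      gcongr
    have e3 : (q / 2 - q / (8 * r)) * √T < (q / 2 + 1 / 8) * √n := by
      have h1 : -(q / (8 * r)) / √n + q / (2 * √n) < q / (2 * √T) + 1 / (8 * √T) := by linarith
      have h2 := mul_lt_mul_of_pos_right h1 (mul_pos hsn hsT)
      have h3 : (-(q / (8 * r)) / √n + q / (2 * √n)) * (√n * √T) =
          (q / 2 - q / (8 * r)) * √T := by field_simp; ring
      have h4 : (q / (2 * √T) + 1 / (8 * √T)) * (√n * √T) = (q / 2 + 1 / 8) * √n := by
        field_simp
      linarith
    have e4 : (q / 2 - q / (8 * r)) * √T < (q / 2 + 1 / 8) * (1 - 1 / (2 * r)) * √T := by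
      linarith
    have e5 := lt_of_mul_lt_mul_right e4 hsT.le
    have e6 : (q / 2 - q / (8 * r)) - (q / 2 + 1 / 8) * (1 - 1 / (2 * r)) =
        (2 * (q - r) + 1) / (16 * r) := by field_simp; ring
    have e7 : 0 < (2 * (q - r) + 1) / (16 * r) := by
      apply div_pos <;> linarith
    linarith

/-- On a low walk the random arm is not pulled any more once the number of its pulls is within
`T / (c √(log T))` of the horizon: its bonus then exceeds the gap by less than the deficit of its
mean. -/
lemma IsUCBVPath.le_pullCount (h : IsUCBVPath ρ T σ A Y) (hρ : 0 < ρ)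
    (h0 : ∀ i, Y 0 i = 1 / 2 + criticalGap ρ T) (hσ0 : σ 0 = 0) (hσ1 : σ 1 = 1 / 2) {r : ℕ}
    (hr : 2 ≤ r) {c : ℝ} (hc0 : 0 < c) (hc : 8 * √ρ ≤ c) (hlog : 0 < Real.log T)
    (hb : c⁻¹ * ((T : ℝ) / √(Real.log T)) + 3 ≤ T / r)
    (hT : 16 * √(ρ * Real.log T) < T) (hT' : 8 * (ρ * Real.log T) ≤ T)
    (hx : (fun i => 2 * Y 1 i - 1) ∈ lowWalk r T) :
    c⁻¹ * ((T : ℝ) / √(Real.log T)) ≤ (pullCount A 0 T : ℝ) := by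
  by_contra! hlt
  set b := c⁻¹ * ((T : ℝ) / √(Real.log T)) with hbdef
  have hr0 : (2 : ℝ) ≤ r := by exact_mod_cast hr
  have hL : 0 < ρ * Real.log T := by positivity
  have hTpos : (0 : ℝ) < T := lt_of_le_of_lt (by positivity) hT
  have hdiv : (T : ℝ) / r < (T / r : ℕ) + 1 := by
    rw [← Nat.floor_div_eq_div (K := ℝ)]
    exact Nat.lt_floor_add_one _
  have hn0 : pullCount A 0 T + 2 < T / r := by
    have : (pullCount A 0 T : ℝ) + 2 < (T / r : ℕ) := by linarith
    exact_mod_cast this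
  have hTr : T / r ≤ T / 2 := Nat.div_le_div_left hr (by norm_num)
  have hsumT := pullCount_add_pullCount A (t := T) (by omega)
  obtain ⟨s, hs3, hsT, hAs, hcount⟩ := exists_last_pull (h.init 1) (T := T) (by omega)
  have hs3 : 3 ≤ s := hs3
  have hg := h.greedy s hs3 hsT.le 0
  obtain ⟨n, hn⟩ : ∃ n, pullCount A 1 s = n := ⟨_, rfl⟩
  have hn1 : 1 ≤ n := hn ▸ h.one_le_pullCount 1 hs3
  have hm1 := h.one_le_pullCount 0 hs3
  have hnT : n ≤ T := by omega
  rw [hAs, ucbvIndex_of_const h0 hσ0 (by omega) hm1,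
    ucbvIndex_of_half hσ1 (by omega) hL hn1 hn, criticalGap_eq] at hg
  have hWn : ∑ i ∈ Finset.range n, (2 * Y 1 i - 1) ≤ -(√T / 4) := hx n (by omega) hnT
  set W := ∑ i ∈ Finset.range n, (2 * Y 1 i - 1) with hW
  set q := √(ρ * Real.log T) with hq
  have hnpos : (0 : ℝ) < n := by exact_mod_cast hn1
  have hsT : 0 < √(T : ℝ) := Real.sqrt_pos.2 hTpos
  have hsn : 0 < √(n : ℝ) := Real.sqrt_pos.2 hnpos
  have hqpos : 0 < q := Real.sqrt_pos.2 hL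
  have hsnT : √(n : ℝ) ≤ √T := Real.sqrt_le_sqrt (by exact_mod_cast hnT)
  have hTT : √(T : ℝ) * √T = T := Real.mul_self_sqrt hTpos.le
  have hnn : √(n : ℝ) * √n = n := Real.mul_self_sqrt hnpos.le
  have hqq : q * q = ρ * Real.log T := Real.mul_self_sqrt hL.le
  -- so late, the bonus of the random arm is governed by its variance
  have hmax : ρ * Real.log T / n ≤ q / (2 * √n) := by
    have h4 : 2 * q ≤ √n := by
      apply Real.le_sqrt_of_sq_le
      have : (T : ℝ) ≤ 2 * n := by exact_mod_cast (by omega : T ≤ 2 * n)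
      nlinarith
    rw [div_le_div_iff₀ hnpos (by positivity), ← hqq]
    nlinarith [mul_le_mul_of_nonneg_left h4 (mul_pos hqpos hsn).le]
  rw [max_eq_left hmax] at hg
  have hpos : 0 < ρ * Real.log T / (pullCount A 0 s : ℝ) :=
    div_pos hL (by exact_mod_cast hm1)
  have hmain : q / (2 * √T) ≤ W / (2 * n) + q / (2 * √n) := by linarith
  have h1 : T / 4 ≤ q * (T - n) := by
    have h2 := mul_le_mul_of_nonneg_right hmain (by positivity : 0 ≤ 2 * (n : ℝ) * √T)
    have h3 : q / (2 * √T) * (2 * (n : ℝ) * √T) = q * n := by field_simp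
    have h4 : (W / (2 * n) + q / (2 * √n)) * (2 * (n : ℝ) * √T) = W * √T + q * (√n * √T) := by
      rw [add_mul]
      congr 1
      · field_simp
      · nth_rw 2 [← hnn]
        field_simp
    have h5 : W * √T ≤ -(√T / 4) * √T := by gcongr
    have h6 : q * (√n * √T) ≤ q * (√T * √T) := by gcongr
    rw [h3, h4] at h2
    rw [neg_mul, div_mul_eq_mul_div, hTT] at h5
    rw [hTT] at h6
    linarith
  have h2 : (T : ℝ) - n < b + 2 := by
    have : (T : ℝ) = pullCount A 0 T + (n + 1) + 1 := by
      exact_mod_cast (by omega : T = pullCount A 0 T + (n + 1) + 1)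
    linarith
  have h3 : q * b ≤ T / 8 := by
    have hsl : 0 < √(Real.log T) := Real.sqrt_pos.2 hlog
    have : q * b = √ρ * T / c := by
      rw [hq, hbdef, Real.sqrt_mul hρ.le]
      field_simp
    rw [this, div_le_div_iff₀ hc0 (by norm_num)]
    linarith [mul_le_mul_of_nonneg_left hc hTpos.le]
  linarith [mul_lt_mul_of_pos_left h2 hqpos]

end Path

/-! ### A maximal inequality and a central limit bound -/

section Walk

variable {Ω : Type*} [mΩ : MeasurableSpace Ω] {P : Measure Ω} {X : ℕ → Ω → ℝ}

/-- The exponential of a walk with independent centred increments is a submartingale. -/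
lemma submartingale_exp_sum [IsProbabilityMeasure P] (hm : ∀ i, Measurable (X i))
    (hind : iIndepFun X P) {t : ℝ} (hint : ∀ i, Integrable (fun ω => Real.exp (t * X i ω)) P)
    (hmean : ∀ i, P[X i] = 0) (hX : ∀ i, Integrable (X i) P) :
    Submartingale (fun n ω => Real.exp (t * ∑ i ∈ Finset.range (n + 1), X i ω))
      (Filtration.natural X fun i => (hm i).stronglyMeasurable) P := by
  set ℱ := Filtration.natural X fun i => (hm i).stronglyMeasurable with hℱ
  have hXmeas : ∀ i n, i ≤ n → Measurable[ℱ n] (X i) := fun i n hin =>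
    ((Filtration.stronglyAdapted_natural (fun i => (hm i).stronglyMeasurable) i).measurable).mono
      (ℱ.mono hin) le_rfl
  have hadp : StronglyAdapted ℱ
      (fun n ω => Real.exp (t * ∑ i ∈ Finset.range (n + 1), X i ω)) := by
    intro n
    refine Measurable.stronglyMeasurable ?_
    refine Real.measurable_exp.comp (Measurable.const_mul ?_ t)
    exact Finset.measurable_fun_sum _ fun i hi => hXmeas i n (by simp at hi; omega)
  have hintS : ∀ n, Integrable
      (fun ω => Real.exp (t * ∑ i ∈ Finset.range (n + 1), X i ω)) P := by
    intro n
    have := hind.integrable_exp_mul_sum hm (t := t) (s := Finset.range (n + 1))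
      fun i _ => hint i
    simpa using this
  refine submartingale_nat hadp hintS fun n => ?_
  have hsplit : (fun ω => Real.exp (t * ∑ i ∈ Finset.range (n + 1 + 1), X i ω)) =
      (fun ω => Real.exp (t * ∑ i ∈ Finset.range (n + 1), X i ω)) *
        fun ω => Real.exp (t * X (n + 1) ω) := by
    ext ω
    simp only [Pi.mul_apply]
    rw [← Real.exp_add, Finset.sum_range_succ, mul_add]
  have hcond : P[fun ω => Real.exp (t * X (n + 1) ω) | ℱ n] =ᵐ[P]
      fun _ => P[fun ω => Real.exp (t * X (n + 1) ω)] := by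
    refine condExp_indep_eq (hm (n + 1)).comap_le (ℱ.le n) ?_
      (hind.indep_comap_natural_of_lt (fun i => (hm i).stronglyMeasurable) n.lt_succ_self)
    refine Measurable.stronglyMeasurable ?_
    exact Real.measurable_exp.comp ((comap_measurable (X (n + 1))).const_mul t)
  have hge : 1 ≤ P[fun ω => Real.exp (t * X (n + 1) ω)] := by
    have h1 : P[fun ω => t * X (n + 1) ω + 1] = 1 := by
      rw [integral_add ((hX _).const_mul t) (integrable_const _), integral_const_mul, hmean]
      simp
    rw [← h1]
    exact integral_mono (((hX _).const_mul t).add (integrable_const _)) (hint _)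
      fun ω => Real.add_one_le_exp _
  have hpull := condExp_mul_of_stronglyMeasurable_left (μ := P) (hadp n)
    (hsplit ▸ hintS (n + 1)) (hint (n + 1))
  rw [hsplit]
  filter_upwards [hpull, hcond] with ω h1 h2
  rw [h1, Pi.mul_apply, h2]
  exact le_mul_of_one_le_right (Real.exp_pos _).le hge

/-- The maximal form of Hoeffding's inequality, from Doob's inequality for the exponential of the
walk. -/
theorem measureReal_exists_le_sum_le [IsProbabilityMeasure P] (hm : ∀ i, Measurable (X i))
    (hind : iIndepFun X P) (hmean : ∀ i, P[X i] = 0)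
    (hsub : ∀ i, HasSubgaussianMGF (X i) 1 P) (N : ℕ) {l : ℝ} (hl : 0 < l) :
    P.real {ω | ∃ n ≤ N, l ≤ ∑ i ∈ Finset.range n, X i ω} ≤ Real.exp (-l ^ 2 / (2 * N)) := by
  obtain rfl | ⟨M, rfl⟩ : N = 0 ∨ ∃ M, N = M + 1 := by
    cases N <;> simp
  · simp
  set N : ℝ := ((M + 1 : ℕ) : ℝ) with hN
  have hNpos : 0 < N := by rw [hN]; positivity
  -- the exponent that optimizes Chernoff's bound
  set t := l / N with ht
  have htpos : 0 < t := by positivity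
  set f : ℕ → Ω → ℝ := fun n ω => Real.exp (t * ∑ i ∈ Finset.range (n + 1), X i ω) with hf
  have hsm : Submartingale f _ P := submartingale_exp_sum hm hind
    (fun i => (hsub i).integrable_exp_mul t) hmean fun i => (hsub i).integrable
  set ε : NNReal := ⟨Real.exp (t * l), (Real.exp_pos _).le⟩ with hε
  have hdoob := maximal_ineq hsm (fun n ω => (Real.exp_pos _).le) (ε := ε) M
  set B := {ω | (ε : ℝ) ≤ (Finset.range (M + 1)).sup' Finset.nonempty_range_add_one
    fun k => f k ω} with hB
  have hsubset : {ω | ∃ n ≤ M + 1, l ≤ ∑ i ∈ Finset.range n, X i ω} ⊆ B := by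
    rintro ω ⟨n, hn, hln⟩
    cases n with
    | zero => simp at hln; linarith
    | succ n =>
      rw [hB, Set.mem_ofPred_eq, Finset.le_sup'_iff]
      refine ⟨n, by simp; omega, ?_⟩
      exact Real.exp_le_exp.2 (by gcongr)
  have hfM : ∫ ω in B, f M ω ∂P ≤ Real.exp (N * t ^ 2 / 2) := by
    refine (setIntegral_le_integral (hsm.integrable M)
      (ae_of_all _ fun ω => (Real.exp_pos _).le)).trans ?_
    have := (HasSubgaussianMGF.sum_of_iIndepFun hind (c := fun _ => 1)
      (s := Finset.range (M + 1)) fun i _ => hsub i).mgf_le t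
    simpa [mgf, hN] using this
  have hBreal : Real.exp (t * l) * P.real B ≤ Real.exp (N * t ^ 2 / 2) := by
    have h1 := ENNReal.toReal_mono ENNReal.ofReal_ne_top hdoob
    rw [ENNReal.toReal_mul, ENNReal.toReal_ofReal
      (integral_nonneg fun ω => (Real.exp_pos _).le)] at h1
    exact h1.trans hfM
  calc P.real {ω | ∃ n ≤ M + 1, l ≤ ∑ i ∈ Finset.range n, X i ω} ≤ P.real B :=
        measureReal_mono hsubset
    _ ≤ Real.exp (N * t ^ 2 / 2) / Real.exp (t * l) := by
        rw [le_div_iff₀ (Real.exp_pos _), mul_comm]; exact hBreal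
    _ = Real.exp (-l ^ 2 / (2 * N)) := by
        rw [← Real.exp_sub, ht]
        congr 1
        field_simp
        ring

/-- By the central limit theorem, a centred walk of unit variance exceeds `√n` with a probability
that is bounded below. -/
theorem exists_le_measureReal_sqrt_le_sum [IsProbabilityMeasure P] (hind : iIndepFun X P)
    (hident : ∀ i, IdentDistrib (X i) (X 0) P P) (hmean : P[X 0] = 0)
    (hvar : P[X 0 ^ 2] = 1) :
    ∃ p > (0 : ℝ), ∀ᶠ n : ℕ in atTop, p ≤ P.real {ω | √n ≤ ∑ i ∈ Finset.range n, X i ω} := by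
  have hclt := tendstoInDistribution_inv_sqrt_mul_sum (P' := gaussianReal 0 1) (Y := id)
    HasLaw.id hmean hvar hind hident
  have hopen := ProbabilityMeasure.le_liminf_measure_open_of_tendsto hclt.tendsto
    (isOpen_Ioi (a := (1 : ℝ)))
  have hpos : 0 < gaussianReal 0 1 (Set.Ioi 1) := by
    refine pos_iff_ne_zero.2 fun h0 => ?_
    simpa using gaussianReal_absolutelyContinuous' 0 one_ne_zero h0
  obtain ⟨p, hp0, hp⟩ : ∃ p : ENNReal, 0 < p ∧ p < gaussianReal 0 1 (Set.Ioi 1) :=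
    exists_between hpos
  have hev := Filter.eventually_lt_of_lt_liminf (lt_of_lt_of_le hp (by simpa using hopen))
  refine ⟨p.toReal, ENNReal.toReal_pos hp0.ne' hp.ne_top, ?_⟩
  filter_upwards [hev, eventually_ge_atTop 1] with n hn hn1
  refine ENNReal.toReal_mono (measure_ne_top _ _) (hn.le.trans ?_)
  change P.map _ (Set.Ioi 1) ≤ _
  rw [Measure.map_apply_of_aemeasurable (hclt.forall_aemeasurable n) measurableSet_Ioi]
  refine measure_mono fun ω hω => ?_
  have hs : 0 < √(n : ℝ) := Real.sqrt_pos.2 (by exact_mod_cast hn1)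
  have hω' : 1 < (√(n : ℝ))⁻¹ * ∑ i ∈ Finset.range n, X i ω := hω
  rw [inv_mul_eq_div, lt_div_iff₀ hs, one_mul] at hω'
  exact hω'.le

/-! ### Probabilities of the two kinds of walks -/

/-- After a step at which the walk exceeds `√n`, it stays of order `√n` for a while, by the maximal
inequality for the later increments. -/
lemma le_measureReal_forall_late [IsProbabilityMeasure P] (hm : ∀ i, Measurable (X i))
    (hind : iIndepFun X P) (hmean : ∀ i, P[X i] = 0)
    (hsub : ∀ i, HasSubgaussianMGF (X i) 1 P) {p : ℝ}
    (hp : ∀ᶠ n : ℕ in atTop, p ≤ P.real {ω | √n ≤ ∑ i ∈ Finset.range n, X i ω}) {r : ℕ}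
    (hr : 2 ≤ r) :
    ∀ᶠ T : ℕ in atTop, p - Real.exp (-(r : ℝ) / 32) ≤
      P.real {ω | ∀ n, T - T / r ≤ n → n ≤ T → √T / 4 ≤ ∑ i ∈ Finset.range n, X i ω} := by
  have htend : Tendsto (fun T : ℕ => T - T / r) atTop atTop := by
    refine tendsto_atTop_mono (fun T => ?_) (Nat.tendsto_div_const_atTop (n := 2) (by norm_num))
    have : T / r ≤ T / 2 := Nat.div_le_div_left hr (by norm_num)
    change T / 2 ≤ T - T / r
    omega
  filter_upwards [htend.eventually hp, eventually_ge_atTop r] with T hT hrT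
  set N := T - T / r with hN
  set M := T / r with hM
  have hM1 : 1 ≤ M := Nat.div_pos hrT (by omega)
  have hMT : M ≤ T := Nat.div_le_self _ _
  have hM2 : M ≤ T / 2 := Nat.div_le_div_left hr (by norm_num)
  have hT0 : (0 : ℝ) < T := by exact_mod_cast (by omega : 0 < T)
  set X' : ℕ → Ω → ℝ := fun i ω => -X (N + i) ω with hX'
  have hind' : iIndepFun X' P :=
    (hind.precomp (add_right_injective N)).comp (fun _ x => -x) fun _ => measurable_neg
  have hbad := measureReal_exists_le_sum_le (X := X') (fun i => (hm (N + i)).neg) hind'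
    (fun i => by simp only [hX', integral_neg, hmean, neg_zero]) (fun i => (hsub (N + i)).neg) M
    (l := √T / 4) (by positivity)
  have hexp : Real.exp (-(√T / 4) ^ 2 / (2 * M)) ≤ Real.exp (-(r : ℝ) / 32) := by
    refine Real.exp_le_exp.2 ?_
    have hM0 : (0 : ℝ) < M := by exact_mod_cast hM1
    have hMr : (M : ℝ) * r ≤ T := by exact_mod_cast Nat.div_mul_le_self T r
    rw [div_pow, Real.sq_sqrt hT0.le, div_le_div_iff₀ (by positivity) (by norm_num)]
    linarith
  set B := {ω | ∃ n ≤ M, √T / 4 ≤ ∑ i ∈ Finset.range n, X' i ω} with hB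
  set G := {ω | √N ≤ ∑ i ∈ Finset.range N, X i ω} with hG
  have hsub : G \ B ⊆
      {ω | ∀ n, N ≤ n → n ≤ T → √T / 4 ≤ ∑ i ∈ Finset.range n, X i ω} := by
    rintro ω ⟨hω, hωB⟩ n hNn hnT
    obtain ⟨j, rfl⟩ := Nat.exists_eq_add_of_le hNn
    simp only [hB, Set.mem_ofPred_eq, not_exists, not_and, not_le] at hωB
    have h1 := hωB j (by omega)
    simp only [hX', Finset.sum_neg_distrib] at h1
    have h2 : √N ≤ ∑ i ∈ Finset.range N, X i ω := hω
    have h3 : √T / 2 ≤ √N := by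
      apply Real.le_sqrt_of_sq_le
      rw [div_pow, Real.sq_sqrt hT0.le]
      have : (T : ℝ) ≤ 2 * N := by exact_mod_cast (by omega : T ≤ 2 * N)
      linarith
    rw [Finset.sum_range_add]
    linarith
  calc p - Real.exp (-(r : ℝ) / 32) ≤ P.real G - P.real B := by
        linarith [hbad.trans hexp]
    _ ≤ P.real (G \ B) := le_measureReal_sdiff
    _ ≤ _ := measureReal_mono hsub

/-- The maximal inequality on dyadic blocks bounds the probability of ever crossing `h √n`. -/
lemma measureReal_exists_sqrt_le_sum_le [IsProbabilityMeasure P] (hm : ∀ i, Measurable (X i))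
    (hind : iIndepFun X P) (hmean : ∀ i, P[X i] = 0)
    (hsub : ∀ i, HasSubgaussianMGF (X i) 1 P) (T : ℕ) {h : ℝ} (hh : 0 < h) :
    P.real {ω | ∃ n, 1 ≤ n ∧ n ≤ T ∧ h * √n ≤ ∑ i ∈ Finset.range n, X i ω} ≤
      (Nat.log 2 T + 1) * Real.exp (-h ^ 2 / 4) := by
  set B : ℕ → Set Ω := fun k =>
    {ω | ∃ n ≤ 2 ^ (k + 1), h * √(2 ^ k) ≤ ∑ i ∈ Finset.range n, X i ω} with hB
  have hsubset : {ω | ∃ n, 1 ≤ n ∧ n ≤ T ∧ h * √n ≤ ∑ i ∈ Finset.range n, X i ω} ⊆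
      ⋃ k ∈ Finset.range (Nat.log 2 T + 1), B k := by
    rintro ω ⟨n, hn1, hnT, hn⟩
    simp only [Set.mem_iUnion]
    refine ⟨Nat.log 2 n, by simpa [Nat.lt_succ_iff] using Nat.log_mono_right hnT, n,
      (Nat.lt_pow_succ_log_self (by norm_num) n).le, le_trans ?_ hn⟩
    have : (2 : ℝ) ^ Nat.log 2 n ≤ n := by exact_mod_cast Nat.pow_log_le_self 2 (by omega)
    gcongr
  have hblock : ∀ k, P.real (B k) ≤ Real.exp (-h ^ 2 / 4) := by
    intro k
    refine (measureReal_exists_le_sum_le hm hind hmean hsub (2 ^ (k + 1))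
      (l := h * √(2 ^ k)) (by positivity)).trans_eq ?_
    rw [mul_pow, Real.sq_sqrt (by positivity)]
    congr 1
    push_cast
    field_simp
    ring
  calc _ ≤ P.real (⋃ k ∈ Finset.range (Nat.log 2 T + 1), B k) :=
        measureReal_mono hsubset (measure_ne_top _ _)
    _ ≤ ∑ k ∈ Finset.range (Nat.log 2 T + 1), P.real (B k) :=
        measureReal_biUnion_finset_le _ _
    _ ≤ ∑ k ∈ Finset.range (Nat.log 2 T + 1), Real.exp (-h ^ 2 / 4) :=
        Finset.sum_le_sum fun k _ => hblock k
    _ = _ := by simp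

lemma tendsto_log_mul_exp_neg {η : ℝ} (hη : 0 < η) :
    Tendsto (fun T : ℕ => ((Nat.log 2 T : ℝ) + 1) * Real.exp (-(η * √(Real.log T)) ^ 2 / 4))
      atTop (𝓝 0) := by
  have hlog : Tendsto (fun T : ℕ => Real.log T) atTop atTop :=
    Real.tendsto_log_atTop.comp tendsto_natCast_atTop_atTop
  have hb : 0 < η ^ 2 / 4 := by positivity
  have h0 : Tendsto (fun x : ℝ => Real.exp (-(η ^ 2 / 4) * x)) atTop (𝓝 0) :=
    Real.tendsto_exp_atBot.comp (tendsto_id.const_mul_atTop_of_neg (by linarith))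
  have h1 : Tendsto (fun x : ℝ => x * Real.exp (-(η ^ 2 / 4) * x)) atTop (𝓝 0) := by
    have h := ((Real.tendsto_pow_mul_exp_neg_atTop_nhds_zero 1).comp
      (tendsto_id.const_mul_atTop hb)).const_mul (η ^ 2 / 4)⁻¹
    rw [mul_zero] at h
    refine h.congr fun x => ?_
    simp only [Function.comp, id, pow_one, neg_mul]
    field_simp
  have h2 := ((h1.const_mul (Real.log 2)⁻¹).add h0).comp hlog
  simp only [mul_zero, add_zero] at h2
  refine squeeze_zero (fun T => by positivity) (fun T => ?_) h2
  have hlogT : 0 ≤ Real.log T := Real.log_natCast_nonneg T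
  have hle : (Nat.log 2 T : ℝ) ≤ (Real.log 2)⁻¹ * Real.log T := by
    have := Real.natLog_le_logb T 2
    rw [Real.logb] at this
    rw [inv_mul_eq_div]
    exact_mod_cast this
  have he : -(η * √(Real.log T)) ^ 2 / 4 = -(η ^ 2 / 4) * Real.log T := by
    rw [mul_pow, Real.sq_sqrt hlogT]; ring
  rw [he]
  simp only [Function.comp]
  have := mul_le_mul_of_nonneg_right hle (Real.exp_pos (-(η ^ 2 / 4) * Real.log T)).le
  linarith

/-- High and low walks both have a probability that is bounded below: the central limit theorem gives
a starting point of probability `p`, and each of the two maximal bounds costs at most `p / 4`. -/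
theorem exists_lt_measureReal_highWalk_lowWalk [IsProbabilityMeasure P]
    (hm : ∀ i, Measurable (X i)) (hind : iIndepFun X P)
    (hident : ∀ i, IdentDistrib (X i) (X 0) P P) (hmean : P[X 0] = 0)
    (hvar : P[X 0 ^ 2] = 1) (hsub : HasSubgaussianMGF (X 0) 1 P) :
    ∃ p > (0 : ℝ), ∃ r : ℕ, 2 ≤ r ∧ ∀ η > (0 : ℝ), ∀ᶠ T : ℕ in atTop,
      p < P.real {ω | (fun i => X i ω) ∈ highWalk r T (η * √(Real.log T))} ∧
      p < P.real {ω | (fun i => X i ω) ∈ lowWalk r T} := by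
  have hmean' : ∀ i, P[X i] = 0 := fun i => (hident i).integral_eq.trans hmean
  have hsub' : ∀ i, HasSubgaussianMGF (X i) 1 P := fun i =>
    hsub.congr_identDistrib (hident i).symm
  -- the reflected walk
  set Z : ℕ → Ω → ℝ := fun i ω => -X i ω with hZ
  have hmZ : ∀ i, Measurable (Z i) := fun i => (hm i).neg
  have hindZ : iIndepFun Z P := hind.comp (fun _ x => -x) fun _ => measurable_neg
  have hidentZ : ∀ i, IdentDistrib (Z i) (Z 0) P P := fun i => (hident i).comp measurable_neg
  have hmeanZ : ∀ i, P[Z i] = 0 := fun i => by simp only [hZ, integral_neg, hmean', neg_zero]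
  have hvarZ : P[Z 0 ^ 2] = 1 := by
    rw [← hvar]; congr 1; ext ω; simp [hZ]
  have hsubZ : ∀ i, HasSubgaussianMGF (Z i) 1 P := fun i => (hsub' i).neg
  obtain ⟨p₁, hp₁, h₁⟩ := exists_le_measureReal_sqrt_le_sum hind hident hmean hvar
  obtain ⟨p₂, hp₂, h₂⟩ := exists_le_measureReal_sqrt_le_sum hindZ hidentZ (hmeanZ 0) hvarZ
  set p := min p₁ p₂ with hp
  have hp0 : 0 < p := lt_min hp₁ hp₂
  obtain ⟨r, hr2, hr⟩ : ∃ r : ℕ, 2 ≤ r ∧ Real.exp (-(r : ℝ) / 32) < p / 4 := by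
    have : Tendsto (fun r : ℕ => Real.exp (-(r : ℝ) / 32)) atTop (𝓝 0) := by
      refine Real.tendsto_exp_atBot.comp ?_
      exact (tendsto_neg_atTop_atBot.comp tendsto_natCast_atTop_atTop).atBot_div_const
        (by norm_num)
    obtain ⟨r, h⟩ := ((this.eventually (gt_mem_nhds (by positivity : 0 < p / 4))).and
      (eventually_ge_atTop 2)).exists
    exact ⟨r, h.2, h.1⟩
  refine ⟨p / 4, by positivity, r, hr2, fun η hη => ?_⟩
  have hlog : ∀ᶠ T : ℕ in atTop, 0 < Real.log T :=
    (Real.tendsto_log_atTop.comp tendsto_natCast_atTop_atTop).eventually_gt_atTop 0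
  filter_upwards [le_measureReal_forall_late hm hind hmean' hsub' h₁ hr2,
    le_measureReal_forall_late hmZ hindZ hmeanZ hsubZ h₂ hr2, hlog,
    (tendsto_log_mul_exp_neg hη).eventually (gt_mem_nhds (by positivity : 0 < p / 4))]
    with T hT₁ hT₂ hlogT hT₃
  have hpp₁ : p ≤ p₁ := min_le_left _ _
  have hpp₂ : p ≤ p₂ := min_le_right _ _
  set h := η * √(Real.log T) with hh
  have hhpos : 0 < h := mul_pos hη (Real.sqrt_pos.2 hlogT)
  have hcross := measureReal_exists_sqrt_le_sum_le hmZ hindZ hmeanZ hsubZ T hhpos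
  constructor
  · set G := {ω | ∀ n, T - T / r ≤ n → n ≤ T → √T / 4 ≤ ∑ i ∈ Finset.range n, X i ω} with hG
    set B := {ω | ∃ n, 1 ≤ n ∧ n ≤ T ∧ h * √n ≤ ∑ i ∈ Finset.range n, Z i ω} with hB
    have hsubset : G \ B ⊆ {ω | (fun i => X i ω) ∈ highWalk r T h} := by
      rintro ω ⟨hω, hωB⟩
      refine ⟨fun n hn1 hnT => ?_, hω⟩
      simp only [hB, Set.mem_ofPred_eq, not_exists, not_and, not_le] at hωB
      have := hωB n hn1 hnT
      simp only [hZ, Finset.sum_neg_distrib] at this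
      linarith
    calc p / 4 < P.real G - P.real B := by linarith
      _ ≤ P.real (G \ B) := le_measureReal_sdiff
      _ ≤ _ := measureReal_mono hsubset
  · have hlow : {ω | (fun i => X i ω) ∈ lowWalk r T} =
        {ω | ∀ n, T - T / r ≤ n → n ≤ T → √T / 4 ≤ ∑ i ∈ Finset.range n, Z i ω} := by
      ext ω
      simp only [lowWalk, hZ, Set.mem_ofPred_eq, Finset.sum_neg_distrib]
      refine forall_congr' fun n => forall_congr' fun _ => forall_congr' fun _ => ?_
      rw [le_neg]
    rw [hlow]
    linarith

end Walk

/-! ### The critical instance -/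

/-- The symmetric law on `{-1, 1}`. -/
noncomputable def signLaw : Measure ℝ :=
  bernoulliMeasure (1 : ℝ) (-1) ⟨1 / 2, by norm_num, by norm_num⟩

instance : IsProbabilityMeasure signLaw := by unfold signLaw; infer_instance

lemma measurableSet_highWalk (r T : ℕ) (h : ℝ) : MeasurableSet (highWalk r T h) := by
  have hS : ∀ n, Measurable fun x : ℕ → ℝ => ∑ i ∈ Finset.range n, x i := fun n => by fun_prop
  rw [highWalk, Set.ofPred_and]
  simp only [Set.ofPred_forall]
  refine MeasurableSet.inter ?_ ?_
  all_goals
    exact MeasurableSet.iInter fun n => MeasurableSet.iInter fun _ => MeasurableSet.iInter fun _ =>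
      measurableSet_le measurable_const (hS n)

lemma measurableSet_lowWalk (r T : ℕ) : MeasurableSet (lowWalk r T) := by
  have hS : ∀ n, Measurable fun x : ℕ → ℝ => ∑ i ∈ Finset.range n, x i := fun n => by fun_prop
  unfold lowWalk
  simp only [Set.ofPred_forall]
  exact MeasurableSet.iInter fun n => MeasurableSet.iInter fun _ => MeasurableSet.iInter fun _ =>
    measurableSet_le (hS n) measurable_const

/-- High and low walks have a probability bounded below, by the same constants for all sequences of
independent signs: their joint law is a fixed product measure. -/
theorem exists_forall_lt_measureReal_signs :
    ∃ p > (0 : ℝ), ∃ r : ℕ, 2 ≤ r ∧ ∀ η > (0 : ℝ), ∀ᶠ T : ℕ in atTop,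
      ∀ (Ω : Type u) [MeasurableSpace Ω] (P : Measure Ω) (X : ℕ → Ω → ℝ),
        iIndepFun X P → (∀ i, HasLaw (X i) signLaw P) →
        p < P.real {ω | (fun i => X i ω) ∈ highWalk r T (η * √(Real.log T))} ∧
        p < P.real {ω | (fun i => X i ω) ∈ lowWalk r T} := by
  set Q := Measure.infinitePi fun _ : ℕ => signLaw with hQ
  set C : ℕ → (ℕ → ℝ) → ℝ := fun i x => x i with hC
  have hind : iIndepFun C Q := iIndepFun_infinitePi (X := fun _ x => x) fun _ => measurable_id
  have hlaw : ∀ i, HasLaw (C i) signLaw Q := fun i =>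
    ⟨(measurable_pi_apply i).aemeasurable, Measure.infinitePi_map_eval _ i⟩
  have hmean : Q[C 0] = 0 := by
    rw [(hlaw 0).integral_eq, signLaw, integral_bernoulliMeasure]
    norm_num
  have hvar : Q[C 0 ^ 2] = 1 := by
    have := (hlaw 0).integral_comp (f := fun x => x ^ 2) (by fun_prop)
    refine this.trans ?_
    rw [signLaw, integral_bernoulliMeasure]
    norm_num
  have hbound : ∀ᵐ x ∂Q, C 0 x ∈ Set.Icc (-1 : ℝ) 1 := by
    refine ((hlaw 0).ae_iff (p := fun x => x ∈ Set.Icc (-1 : ℝ) 1) ?_).2 ?_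
    · exact measurableSet_setOfPred.1 measurableSet_Icc
    · rw [ae_iff, signLaw, ← Set.compl_ofPred, bernoulliMeasure_apply_of_notMem_of_notMem]
      · exact measurableSet_Icc.compl
      all_goals simp
  have hsub : HasSubgaussianMGF (C 0) 1 Q := by
    have := hasSubgaussianMGF_of_mem_Icc_of_integral_eq_zero (hlaw 0).aemeasurable hbound hmean
    convert this using 1
    ext
    norm_num
  obtain ⟨p, hp, r, hr, h⟩ := exists_lt_measureReal_highWalk_lowWalk
    (fun i => measurable_pi_apply i) hind (fun i => (hlaw i).identDistrib (hlaw 0)) hmean hvar hsub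
  refine ⟨p, hp, r, hr, fun η hη => ?_⟩
  filter_upwards [h η hη] with T hT Ω _ P X hX hlawX
  have hid := IdentDistrib.pi (fun i => (hlawX i).identDistrib (hlaw i)) hX hind
  have hreal : ∀ s : Set (ℕ → ℝ), MeasurableSet s →
      P.real {ω | (fun i => X i ω) ∈ s} = Q.real {x | (fun i => C i x) ∈ s} := fun s hs =>
    congrArg ENNReal.toReal (hid.measure_mem_eq hs)
  rw [hreal _ (measurableSet_highWalk _ _ _), hreal _ (measurableSet_lowWalk _ _)]
  exact hT

lemma stdDev_criticalInstance_zero (ρ : ℝ) (T : ℕ) : stdDev (criticalInstance ρ T 0) = 0 := by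
  simp [stdDev, criticalInstance]

lemma stdDev_criticalInstance_one (ρ : ℝ) (T : ℕ) :
    stdDev (criticalInstance ρ T 1) = 1 / 2 := by
  have hm : ∫ x, x ∂(criticalInstance ρ T 1) = 1 / 2 := by
    simp only [criticalInstance, Matrix.cons_val_one, Matrix.cons_val_fin_one]
    rw [integral_bernoulliMeasure]; norm_num
  have hv : variance id (criticalInstance ρ T 1) = (1 / 2) ^ 2 := by
    rw [variance_eq_integral aemeasurable_id]
    simp only [id, hm]
    simp only [criticalInstance, Matrix.cons_val_one, Matrix.cons_val_fin_one]
    rw [integral_bernoulliMeasure]; norm_num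
  rw [stdDev, hv, Real.sqrt_sq (by norm_num)]

section Run

variable {Ω : Type*} [MeasurableSpace Ω] {P : Measure Ω} {ρ : ℝ} {T : ℕ} {A : ℕ → Ω → Fin 2}
  {Y : Fin 2 → ℕ → Ω → ℝ}

/-- The rescaled rewards of the random arm are independent signs. -/
lemma IsOracleUCBVRun.iIndepFun_signs (h : IsOracleUCBVRun P ρ T (criticalInstance ρ T) A Y) :
    iIndepFun (fun i ω => 2 * Y 1 i ω - 1) P :=
  (h.indep.precomp (g := fun i : ℕ => ((1 : Fin 2), i)) fun i j hij => by simpa using hij).comp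
    (fun _ x => 2 * x - 1) fun _ => by fun_prop

lemma IsOracleUCBVRun.hasLaw_signs (h : IsOracleUCBVRun P ρ T (criticalInstance ρ T) A Y) (i : ℕ) :
    HasLaw (fun ω => 2 * Y 1 i ω - 1) signLaw P := by
  have hf : Measurable fun x : ℝ => 2 * x - 1 := by fun_prop
  refine HasLaw.fun_comp (Y := fun x : ℝ => 2 * x - 1) ⟨hf.aemeasurable, ?_⟩ (h.law 1 i)
  simp only [criticalInstance, Matrix.cons_val_one, Matrix.cons_val_fin_one]
  rw [map_bernoulliMeasure' _ _ hf, signLaw]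
  norm_num

lemma IsOracleUCBVRun.ae_reward_zero (h : IsOracleUCBVRun P ρ T (criticalInstance ρ T) A Y) :
    ∀ᵐ ω ∂P, ∀ i, Y 0 i ω = 1 / 2 + criticalGap ρ T :=
  ae_all_iff.2 fun i => HasLaw.ae_eq_of_dirac (h.law 0 i)

end Run

/-- With probability bounded below, the deterministic arm is pulled `O(√T log T)` times, and with
probability bounded below it is pulled `Ω(T / √(log T))` times. -/
theorem exists_forall_lt_measureReal_pullCount {ρ : ℝ} (hρ : 0 < ρ) :
    ∃ c₀ > (0 : ℝ), ∃ c₁ > (0 : ℝ), ∃ T₀ : ℕ, ∀ T : ℕ, T₀ ≤ T →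
      ∀ (Ω : Type u) [MeasurableSpace Ω] (P : Measure Ω) [IsProbabilityMeasure P]
        (A : ℕ → Ω → Fin 2) (Y : Fin 2 → ℕ → Ω → ℝ),
        IsOracleUCBVRun P ρ T (criticalInstance ρ T) A Y →
        c₀ < P.real {ω | (pullCount (fun t => A t ω) 0 T : ℝ) ≤ c₁ * (√(T : ℝ) * Real.log T)} ∧
        c₀ < P.real {ω | c₁⁻¹ * ((T : ℝ) / √(Real.log T)) ≤
          (pullCount (fun t => A t ω) 0 T : ℝ)} := by
  obtain ⟨p, hp, r, hr, h⟩ := exists_forall_lt_measureReal_signs.{u}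
  have hr0 : (2 : ℝ) ≤ r := by exact_mod_cast hr
  set c := 17 * ρ + 8 * √ρ + 1 with hc
  have hsρ : 0 < √ρ := Real.sqrt_pos.2 hρ
  have hcpos : 0 < c := by positivity
  have hlog : Tendsto (fun T : ℕ => Real.log T) atTop atTop :=
    Real.tendsto_log_atTop.comp tendsto_natCast_atTop_atTop
  have hslog : Tendsto (fun T : ℕ => √(Real.log T)) atTop atTop :=
    Real.tendsto_sqrt_atTop.comp hlog
  have hloglin : ∀ᶠ T : ℕ in atTop, 17 * (ρ * Real.log T) ≤ T := by
    have := (Real.isLittleO_log_id_atTop.comp_tendsto tendsto_natCast_atTop_atTop).bound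
      (by positivity : 0 < 1 / (17 * ρ))
    filter_upwards [this] with T hT
    simp only [Function.comp, id, Real.norm_eq_abs, Nat.abs_cast] at hT
    have h1 := (le_abs_self _).trans hT
    rw [div_mul_eq_mul_div, one_mul, le_div_iff₀ (by positivity)] at h1
    linarith
  refine ⟨p, hp, c, hcpos, eventually_atTop.1 ?_⟩
  filter_upwards [h (√ρ / (4 * r)) (by positivity), hloglin,
    (hlog.const_mul_atTop hρ).eventually_gt_atTop ((r : ℝ) ^ 2), hlog.eventually_ge_atTop 2,
    hslog.eventually_ge_atTop (2 * r / c), eventually_ge_atTop (6 * r)]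
    with T hT hlin hrlog hlog2 hslogT hTr Ω _ P _ A Y hrun
  obtain ⟨hhigh, hlow⟩ := hT Ω P _ hrun.iIndepFun_signs hrun.hasLaw_signs
  have hlogpos : 0 < Real.log T := by linarith
  have hslpos : 0 < √(Real.log T) := Real.sqrt_pos.2 hlogpos
  have hTr' : 6 * (r : ℝ) ≤ T := by exact_mod_cast hTr
  have hL1 : 1 ≤ ρ * Real.log T := by nlinarith
  have hh : √ρ / (4 * r) * √(Real.log T) = √(ρ * Real.log T) / (4 * r) := by
    rw [Real.sqrt_mul hρ.le]; ring
  rw [hh] at hhigh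
  constructor
  · refine hhigh.trans_le (ENNReal.toReal_mono (measure_ne_top _ _)
      (measure_mono_ae (hrun.ae_reward_zero.mono fun ω h0 hx => ?_)))
    refine (hrun.path ω).pullCount_le hρ h0 (stdDev_criticalInstance_zero ρ T)
      (stdDev_criticalInstance_one ρ T) hr (by rw [hc]; linarith) ?_ hrlog hx
    have h1 : 1 ≤ √(T : ℝ) := Real.one_le_sqrt.2 (by linarith)
    have h2 : 1 ≤ c := by rw [hc]; nlinarith
    nlinarith [mul_le_mul h1 hlog2 (by norm_num) (by linarith)]
  · refine hlow.trans_le (ENNReal.toReal_mono (measure_ne_top _ _)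
      (measure_mono_ae (hrun.ae_reward_zero.mono fun ω h0 hx => ?_)))
    refine (hrun.path ω).le_pullCount hρ h0 (stdDev_criticalInstance_zero ρ T)
      (stdDev_criticalInstance_one ρ T) hr hcpos (by rw [hc]; linarith) hlogpos ?_ ?_ ?_ hx
    · have h1 : c⁻¹ * ((T : ℝ) / √(Real.log T)) ≤ T / (2 * r) := by
        rw [div_le_iff₀ hcpos] at hslogT
        rw [inv_mul_eq_div, div_div, div_le_div_iff₀ (by positivity) (by positivity)]
        gcongr
      have h2 : 3 ≤ (T : ℝ) / (2 * r) := by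
        rw [le_div_iff₀ (by positivity)]; linarith
      have h3 : (T : ℝ) / r = T / (2 * r) + T / (2 * r) := by field_simp; ring
      linarith
    · have : √(ρ * Real.log T) ≤ ρ * Real.log T := Real.sqrt_le_iff.2 ⟨by linarith, by nlinarith⟩
      linarith
    · linarith

/-- The orders of magnitude `√T log T` and `T / √(log T)` separate, so that no deterministic sequence
is comparable to both. -/
lemma eventually_two_mul_lt {c : ℝ} (hc : 0 < c) :
    ∀ᶠ T : ℕ in atTop,
      2 * (c * (√(T : ℝ) * Real.log T)) < c⁻¹ * ((T : ℝ) / √(Real.log T)) := by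
  have hlog : Tendsto (fun T : ℕ => Real.log T) atTop atTop :=
    Real.tendsto_log_atTop.comp tendsto_natCast_atTop_atTop
  have hpow := (Real.isLittleO_pow_log_id_atTop (n := 4)).comp_tendsto
    (tendsto_natCast_atTop_atTop (R := ℝ))
  filter_upwards [hpow.bound (by positivity : 0 < 1 / (2 * (2 * c ^ 2) ^ 2)),
    hlog.eventually_ge_atTop 1, eventually_ge_atTop 1] with T hT hlog1 hT1
  have hTpos : (0 : ℝ) < T := by exact_mod_cast hT1
  have hsl : 0 < √(Real.log T) := Real.sqrt_pos.2 (by linarith)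
  have hsT : 0 < √(T : ℝ) := Real.sqrt_pos.2 hTpos
  simp only [Function.comp, id, Real.norm_eq_abs, Nat.abs_cast] at hT
  have h1 := (le_abs_self _).trans hT
  rw [div_mul_eq_mul_div, one_mul, le_div_iff₀ (by positivity)] at h1
  have h2 : 2 * c ^ 2 * Real.log T ^ 2 < √T := by
    apply Real.lt_sqrt_of_sq_lt
    have : 0 < (2 * c ^ 2) ^ 2 * Real.log T ^ 4 := by positivity
    linarith [show (2 * c ^ 2 * Real.log T ^ 2) ^ 2 = (2 * c ^ 2) ^ 2 * Real.log T ^ 4 by ring]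
  rw [inv_mul_eq_div, div_div, lt_div_iff₀ (by positivity)]
  calc 2 * (c * (√T * Real.log T)) * (√(Real.log T) * c)
      = 2 * c ^ 2 * (Real.log T * √(Real.log T)) * √T := by ring
    _ ≤ 2 * c ^ 2 * (Real.log T * Real.log T) * √T := by
        gcongr
        exact Real.sqrt_le_iff.2 ⟨by linarith, by nlinarith⟩
    _ = 2 * c ^ 2 * Real.log T ^ 2 * √T := by ring
    _ < √T * √T := by gcongr
    _ = T := Real.mul_self_sqrt hTpos.le

theorem proposition3p5 (ρ : ℝ) (hρ : 0 < ρ) :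
    (∃ c₀ > (0 : ℝ), ∃ c₁ > (0 : ℝ), ∃ T₀ : ℕ, ∀ T : ℕ, T₀ ≤ T →
      ∀ (Ω : Type u) [MeasurableSpace Ω] (P : Measure Ω) [IsProbabilityMeasure P]
        (A : ℕ → Ω → Fin 2) (Y : Fin 2 → ℕ → Ω → ℝ),
        IsOracleUCBVRun P ρ T (criticalInstance ρ T) A Y →
        c₀ < P.real {ω | (pullCount (fun t => A t ω) 0 T : ℝ) ≤ c₁ * (√(T : ℝ) * Real.log T)} ∧
        c₀ < P.real {ω | c₁⁻¹ * ((T : ℝ) / √(Real.log T)) ≤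
          (pullCount (fun t => A t ω) 0 T : ℝ)}) ∧
    (∀ (Ω : ℕ → Type u) [∀ T, MeasurableSpace (Ω T)] (P : ∀ T, Measure (Ω T))
        [∀ T, IsProbabilityMeasure (P T)]
        (A : ∀ T, ℕ → Ω T → Fin 2) (Y : ∀ T, Fin 2 → ℕ → Ω T → ℝ),
        (∀ T, IsOracleUCBVRun (P T) ρ T (criticalInstance ρ T) (A T) (Y T)) →
        ¬ ∃ nstar : ℕ → ℝ, ∀ ε > (0 : ℝ),
          Tendsto (fun T => (P T).real
            {ω | ε < |(pullCount (fun t => A T t ω) 0 T : ℝ) / nstar T - 1|}) atTop (𝓝 0)) := by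
  refine ⟨exists_forall_lt_measureReal_pullCount hρ, ?_⟩
  rintro Ω _ P _ A Y hrun ⟨nstar, hstar⟩
  obtain ⟨c₀, hc₀, c₁, hc₁, T₀, h⟩ := exists_forall_lt_measureReal_pullCount.{u} hρ
  obtain ⟨T, hT₀, hsmall, hsep⟩ := ((eventually_ge_atTop T₀).and
    (((hstar (1 / 4) (by norm_num)).eventually (gt_mem_nhds hc₀)).and
      (eventually_two_mul_lt hc₁))).exists
  obtain ⟨hlow, hhigh⟩ := h T hT₀ (Ω T) (P T) (A T) (Y T) (hrun T)
  -- an event more likely than the deviation meets its complement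
  have hmeet : ∀ E : Set (Ω T), c₀ < (P T).real E →
      ∃ ω ∈ E, |(pullCount (fun t => A T t ω) 0 T : ℝ) / nstar T - 1| ≤ 1 / 4 := by
    intro E hE
    by_contra! hcon
    exact (hE.trans_le (measureReal_mono hcon)).not_gt hsmall
  obtain ⟨ω₁, hω₁, h₁⟩ := hmeet _ hlow
  obtain ⟨ω₂, hω₂, h₂⟩ := hmeet _ hhigh
  have hω₁ : (pullCount (fun t => A T t ω₁) 0 T : ℝ) ≤ c₁ * (√(T : ℝ) * Real.log T) := hω₁
  have hω₂ : c₁⁻¹ * ((T : ℝ) / √(Real.log T)) ≤ pullCount (fun t => A T t ω₂) 0 T := hω₂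
  rw [abs_le] at h₁ h₂
  have hn₁ : (0 : ℝ) ≤ pullCount (fun t => A T t ω₁) 0 T := Nat.cast_nonneg _
  have hpos : 0 < nstar T := by
    by_contra! hneg
    have := div_nonpos_of_nonneg_of_nonpos hn₁ hneg
    linarith
  have e₁ : 3 / 4 * nstar T ≤ pullCount (fun t => A T t ω₁) 0 T := by
    rw [← le_div_iff₀ hpos]; linarith
  have e₂ : (pullCount (fun t => A T t ω₂) 0 T : ℝ) ≤ 5 / 4 * nstar T := by
    rw [← div_le_iff₀ hpos]; linarith
  linarith
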